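/- Let $n\ge 2$ be an integer, let $X$ be a random vector uniformly distributed (with respect to normalised surface measure) on $\sqrt{n}\,S^{n-1}$, the sphere of radius $\sqrt n$ centred at the origin of $\mathbb{R}^n$, and let $\theta\in\mathbb{R}^n$ be a unit vector. Put $W=\langle X,\theta\rangle$ and let $Z$ be a standard Gaussian random variable, $Z\sim N(0,1)$. Then $$d_{TV}(W,Z)\le \frac{2\sqrt{2}}{\sqrt{(n-1)(n+2)}},$$ where $d_{TV}(W,Z)=\tfrac12\sup_g|\mathbb{E}g(W)-\mathbb{E}g(Z)|$, the supremum being over all continuous $g:\mathbb{R}\to\mathbb{R}$ with $|g|\le 1$. -/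

import Mathlib

open MeasureTheory ProbabilityTheory

noncomputable section

/-- The uniform probability measure on the sphere of radius `r` centred at the origin of
Euclidean space `ℝⁿ`, regarded as a measure on `ℝⁿ`: the surface measure
`volume.toSphere` of the unit sphere, normalised to total mass one and pushed forward
under `x ↦ r • x`. -/
def sphereUniform (n : ℕ) (r : ℝ) : Measure (EuclideanSpace ℝ (Fin n)) :=
  (((volume : Measure (EuclideanSpace ℝ (Fin n))).toSphere Set.univ)⁻¹ •
    (volume : Measure (EuclideanSpace ℝ (Fin n))).toSphere).map
      (fun x : Metric.sphere (0 : EuclideanSpace ℝ (Fin n)) 1 =>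
        r • (x : EuclideanSpace ℝ (Fin n)))

/-- The total variation distance of two real random variables, which may live on different
probability spaces: one half of the supremum of `|𝔼 g(X) - 𝔼 g(Y)|` over all continuous
`g : ℝ → ℝ` bounded by `1`. (For probability measures `P` and `Q` the set below is nonempty
and bounded above by `2`, so the supremum is a genuine one.) -/
def tvDist {Ω Ω' : Type*} [MeasurableSpace Ω] [MeasurableSpace Ω']
    (X : Ω → ℝ) (P : Measure Ω) (Y : Ω' → ℝ) (Q : Measure Ω') : ℝ :=
  (1 / 2) * sSup {d : ℝ | ∃ g : ℝ → ℝ, Continuous g ∧ (∀ x, |g x| ≤ 1) ∧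
    d = |(∫ ω, g (X ω) ∂P) - ∫ ω, g (Y ω) ∂Q|}

end

/-!
The proof is Stein's method. Let `g` be continuous with `|g| ≤ 1` and put `h = g - 𝔼 g(Z)`, so
that `|h| ≤ 2` and `h` has Gaussian mean zero. Stein's equation `f' x - x * f x = h x` then has a
`C¹` solution with `|f'| ≤ 4` (`exists_stein_solution`).

The uniform measure on the sphere is invariant under linear isometries. Rotating by an angle `t` in
the plane of `θ` and an orthogonal unit vector `v` therefore leaves `𝔼 [⟪X, v⟫ * f ⟪X, θ⟫]`
unchanged; differentiating at `t = 0` and summing over `v` in an orthonormal basis of the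
orthogonal complement of `θ` gives, for `W = ⟪X, θ⟫` and every `C¹` function `f`,
`𝔼 [(n - W ^ 2) * f' W] = (n - 1) * 𝔼 [W * f W]` (`sphereUniform_stein_identity`).
With `f x = x` and `f x = x ^ 3` this yields `𝔼 W ^ 2 = 1` and `𝔼 W ^ 4 = 3 n / (n + 2)`, hence
`𝔼 |W ^ 2 - 1| ≤ √(2 (n - 1) / (n + 2))`. With `f` the solution of Stein's equation it yields
`𝔼 g(W) - 𝔼 g(Z) = 𝔼 [f' W - W * f W] = 𝔼 [f' W * (W ^ 2 - 1)] / (n - 1)`,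
which is at most `4 * 𝔼 |W ^ 2 - 1| / (n - 1)` in absolute value. Half of this is the claimed bound.
-/

/-! ### The Gaussian Stein equation -/

lemma hasDerivAt_exp_neg_half_mul_sq (x : ℝ) :
    HasDerivAt (fun t : ℝ => Real.exp (-(1 / 2) * t ^ 2)) (-(x * Real.exp (-(1 / 2) * x ^ 2))) x := by
  convert ((hasDerivAt_pow 2 x).const_mul (-(1 / 2) : ℝ)).exp using 1
  norm_num
  ring

lemma tendsto_exp_neg_half_mul_sq_atTop :
    Filter.Tendsto (fun t : ℝ => Real.exp (-(1 / 2) * t ^ 2)) Filter.atTop (nhds 0) := by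
  refine Real.tendsto_exp_atBot.comp ?_
  exact (Filter.tendsto_pow_atTop two_ne_zero).const_mul_atTop_of_neg (by norm_num)

lemma tendsto_exp_neg_half_mul_sq_atBot :
    Filter.Tendsto (fun t : ℝ => Real.exp (-(1 / 2) * t ^ 2)) Filter.atBot (nhds 0) := by
  simpa [Function.comp_def] using
    tendsto_exp_neg_half_mul_sq_atTop.comp Filter.tendsto_neg_atBot_atTop

lemma integrable_id_mul_exp_neg_half_mul_sq :
    Integrable fun t : ℝ => t * Real.exp (-(1 / 2) * t ^ 2) :=
  integrable_mul_exp_neg_mul_sq (by norm_num)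

lemma integral_Ioi_id_mul_exp_neg_half_mul_sq (x : ℝ) :
    ∫ t in Set.Ioi x, t * Real.exp (-(1 / 2) * t ^ 2) = Real.exp (-(1 / 2) * x ^ 2) := by
  have := integral_Ioi_of_hasDerivAt_of_tendsto' (a := x)
    (fun y _ => hasDerivAt_exp_neg_half_mul_sq y)
    integrable_id_mul_exp_neg_half_mul_sq.neg.integrableOn tendsto_exp_neg_half_mul_sq_atTop
  rw [integral_neg] at this
  linarith

lemma integral_Iic_id_mul_exp_neg_half_mul_sq (x : ℝ) :
    ∫ t in Set.Iic x, t * Real.exp (-(1 / 2) * t ^ 2) = -Real.exp (-(1 / 2) * x ^ 2) := by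
  have := integral_Iic_of_hasDerivAt_of_tendsto' (a := x)
    (fun y _ => hasDerivAt_exp_neg_half_mul_sq y)
    integrable_id_mul_exp_neg_half_mul_sq.neg.integrableOn tendsto_exp_neg_half_mul_sq_atBot
  rw [integral_neg] at this
  linarith

lemma integrable_bounded_mul_exp_neg_half_mul_sq {h : ℝ → ℝ} (hc : Continuous h) {c : ℝ}
    (hb : ∀ x, |h x| ≤ c) : Integrable fun t : ℝ => h t * Real.exp (-(1 / 2) * t ^ 2) :=
  (integrable_exp_neg_mul_sq (by norm_num : (0 : ℝ) < 1 / 2)).bdd_mul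
    hc.aestronglyMeasurable (ae_of_all _ hb)

/-- The Gaussian tail estimate behind the bound on the derivative of a solution of Stein's
equation. The left tail is used for `x ≤ 0` and the right tail for `0 ≤ x`: there `|x| ≤ |t|` on
the domain of integration, and `t * exp (-t ^ 2 / 2)` has an explicit primitive. -/
lemma abs_mul_integral_Iic_le {h : ℝ → ℝ} (hc : Continuous h) {c : ℝ}
    (hb : ∀ x, |h x| ≤ c) (h0 : ∫ t, h t * Real.exp (-(1 / 2) * t ^ 2) = 0) (x : ℝ) :
    |x * ∫ t in Set.Iic x, h t * Real.exp (-(1 / 2) * t ^ 2)| ≤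
      c * Real.exp (-(1 / 2) * x ^ 2) := by
  have hint := integrable_bounded_mul_exp_neg_half_mul_sq hc hb
  have hc0 : 0 ≤ c := (abs_nonneg _).trans (hb 0)
  rcases le_total x 0 with hx | hx
  · rw [← integral_const_mul, ← Real.norm_eq_abs]
    calc ‖∫ t in Set.Iic x, x * (h t * Real.exp (-(1 / 2) * t ^ 2))‖
        ≤ ∫ t in Set.Iic x, (-c) * (t * Real.exp (-(1 / 2) * t ^ 2)) := by
          refine norm_integral_le_of_norm_le
            (integrable_id_mul_exp_neg_half_mul_sq.const_mul _).integrableOn ?_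
          filter_upwards [ae_restrict_mem measurableSet_Iic] with t ht
          rw [Set.mem_Iic] at ht
          rw [Real.norm_eq_abs, abs_mul, abs_mul, abs_of_nonpos hx, Real.abs_exp,
            show -c * (t * Real.exp (-(1 / 2) * t ^ 2)) =
              -t * (c * Real.exp (-(1 / 2) * t ^ 2)) by ring]
          gcongr
          · linarith
          · exact hb t
      _ = c * Real.exp (-(1 / 2) * x ^ 2) := by
          rw [integral_const_mul, integral_Iic_id_mul_exp_neg_half_mul_sq]; ring
  · have hsplit : ∫ t in Set.Iic x, h t * Real.exp (-(1 / 2) * t ^ 2) =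
        -∫ t in Set.Ioi x, h t * Real.exp (-(1 / 2) * t ^ 2) := by
      have := intervalIntegral.integral_Iic_add_Ioi (b := x) hint.integrableOn hint.integrableOn
      linarith
    rw [hsplit, mul_neg, abs_neg, ← integral_const_mul, ← Real.norm_eq_abs]
    calc ‖∫ t in Set.Ioi x, x * (h t * Real.exp (-(1 / 2) * t ^ 2))‖
        ≤ ∫ t in Set.Ioi x, c * (t * Real.exp (-(1 / 2) * t ^ 2)) := by
          refine norm_integral_le_of_norm_le
            (integrable_id_mul_exp_neg_half_mul_sq.const_mul _).integrableOn ?_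
          filter_upwards [ae_restrict_mem measurableSet_Ioi] with t ht
          rw [Set.mem_Ioi] at ht
          rw [Real.norm_eq_abs, abs_mul, abs_mul, abs_of_nonneg hx, Real.abs_exp,
            mul_left_comm c]
          have ht0 : 0 ≤ t := hx.trans ht.le
          gcongr
          exact hb t
      _ = c * Real.exp (-(1 / 2) * x ^ 2) := by
          rw [integral_const_mul, integral_Ioi_id_mul_exp_neg_half_mul_sq]

/-- Stein's equation `f' x - x * f x = h x` for a bounded continuous `h` of Gaussian mean zero has
a `C¹` solution whose derivative is at most twice the bound on `h`. -/
lemma exists_stein_solution {h : ℝ → ℝ} (hc : Continuous h) {c : ℝ}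
    (hb : ∀ x, |h x| ≤ c) (h0 : ∫ t, h t * Real.exp (-(1 / 2) * t ^ 2) = 0) :
    ∃ f f' : ℝ → ℝ, Continuous f' ∧ (∀ x, HasDerivAt f (f' x) x) ∧
      (∀ x, f' x - x * f x = h x) ∧ ∀ x, |f' x| ≤ 2 * c := by
  have hint := integrable_bounded_mul_exp_neg_half_mul_sq hc hb
  -- The solution is `x ↦ exp (x ^ 2 / 2) * ∫ t in Iic x, h t * exp (-t ^ 2 / 2)`.
  set q : ℝ → ℝ := fun t => h t * Real.exp (-(1 / 2) * t ^ 2) with hq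
  have hqc : Continuous q := by fun_prop
  set F : ℝ → ℝ := fun x => ∫ t in Set.Iic x, q t with hF
  have hFd : ∀ x, HasDerivAt F (q x) x := by
    intro x
    have h1 : F = fun y => F 0 + ∫ t in (0 : ℝ)..y, q t := by
      funext y
      have := intervalIntegral.integral_Iic_sub_Iic (f := q) (a := 0) (b := y)
        hint.integrableOn hint.integrableOn
      simp only [hF]
      linarith
    rw [h1]
    exact (intervalIntegral.integral_hasDerivAt_right (hqc.intervalIntegrable _ _)
      (hqc.stronglyMeasurableAtFilter _ _) hqc.continuousAt).const_add _
  have hEd : ∀ x : ℝ, HasDerivAt (fun t : ℝ => Real.exp (1 / 2 * t ^ 2))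
      (x * Real.exp (1 / 2 * x ^ 2)) x := by
    intro x
    convert ((hasDerivAt_pow 2 x).const_mul (1 / 2 : ℝ)).exp using 1
    norm_num
    ring
  have hee : ∀ x : ℝ, Real.exp (-(1 / 2) * x ^ 2) * Real.exp (1 / 2 * x ^ 2) = 1 := by
    intro x
    rw [← Real.exp_add]
    simp
  have hFc : Continuous F := continuous_iff_continuousAt.2 fun x => (hFd x).continuousAt
  refine ⟨fun x => F x * Real.exp (1 / 2 * x ^ 2),
    fun x => h x + x * (F x * Real.exp (1 / 2 * x ^ 2)), by fun_prop, ?_, ?_, ?_⟩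
  · intro x
    refine ((hFd x).mul (hEd x)).congr_deriv ?_
    simp only [hq]
    linear_combination h x * hee x
  · intro x
    ring
  · intro x
    have h1 := abs_mul_integral_Iic_le hc hb h0 x
    have h2 : |x * (F x * Real.exp (1 / 2 * x ^ 2))| ≤ c := by
      rw [← mul_assoc, abs_mul, Real.abs_exp]
      calc |x * F x| * Real.exp (1 / 2 * x ^ 2)
          ≤ c * Real.exp (-(1 / 2) * x ^ 2) * Real.exp (1 / 2 * x ^ 2) := by gcongr
        _ = c := by rw [mul_assoc, hee, mul_one]
    calc _ ≤ |h x| + |x * (F x * Real.exp (1 / 2 * x ^ 2))| := abs_add_le _ _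
      _ ≤ 2 * c := by linarith [hb x]

lemma integral_mul_exp_neg_half_mul_sq_eq_zero {g : ℝ → ℝ} (hg : Integrable g (gaussianReal 0 1)) :
    ∫ t, (g t - ∫ z, g z ∂gaussianReal 0 1) * Real.exp (-(1 / 2) * t ^ 2) = 0 := by
  have h1 : ∫ t, (g t - ∫ z, g z ∂gaussianReal 0 1) ∂gaussianReal 0 1 = 0 := by
    rw [integral_sub hg (integrable_const _)]
    simp
  rw [integral_gaussianReal_eq_integral_smul one_ne_zero] at h1
  have h2 : ∀ t : ℝ, gaussianPDFReal 0 1 t • (g t - ∫ z, g z ∂gaussianReal 0 1) =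
      (√(2 * Real.pi))⁻¹ *
        ((g t - ∫ z, g z ∂gaussianReal 0 1) * Real.exp (-(1 / 2) * t ^ 2)) := by
    intro t
    rw [gaussianPDFReal_def, smul_eq_mul]
    simp only [NNReal.coe_one, mul_one, sub_zero]
    rw [show -t ^ 2 / 2 = -(1 / 2) * t ^ 2 by ring]
    ring
  simp only [h2] at h1
  rw [integral_const_mul] at h1
  exact (mul_eq_zero.1 h1).resolve_left (by positivity)

/-! ### Stein identity for rotation-invariant measures -/

section Rotation

variable {E : Type*} [NormedAddCommGroup E] [InnerProductSpace ℝ E] [FiniteDimensional ℝ E]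

/-- The rotation by the angle `t` in the plane spanned by the orthonormal vectors `u`, `v`, given
through its effect on the two coordinates. -/
lemma exists_plane_rotation {u v : E} (hu : ‖u‖ = 1) (hv : ‖v‖ = 1) (huv : inner ℝ u v = 0)
    (t : ℝ) : ∃ L : E ≃ₗᵢ[ℝ] E, ∀ x,
      inner ℝ (L x) u = Real.cos t * inner ℝ x u + Real.sin t * inner ℝ x v ∧
      inner ℝ (L x) v = Real.cos t * inner ℝ x v - Real.sin t * inner ℝ x u := by
  have huu : inner ℝ u u = 1 := by rw [real_inner_self_eq_norm_sq, hu]; norm_num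
  have hvv : inner ℝ v v = 1 := by rw [real_inner_self_eq_norm_sq, hv]; norm_num
  have hvu : inner ℝ v u = 0 := by rw [real_inner_comm, huv]
  let A : E →ₗ[ℝ] E := LinearMap.id +
    (((Real.cos t - 1) • (innerₗ E u) + Real.sin t • (innerₗ E v)).smulRight u +
      ((Real.cos t - 1) • (innerₗ E v) - Real.sin t • (innerₗ E u)).smulRight v)
  have hA : ∀ x, A x = x + (((Real.cos t - 1) * inner ℝ x u + Real.sin t * inner ℝ x v) • u +
      ((Real.cos t - 1) * inner ℝ x v - Real.sin t * inner ℝ x u) • v) := by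
    intro x
    simp [A, real_inner_comm]
  have hn : ∀ x, ‖A x‖ = ‖x‖ := by
    intro x
    rw [← sq_eq_sq₀ (norm_nonneg _) (norm_nonneg _), ← real_inner_self_eq_norm_sq,
      ← real_inner_self_eq_norm_sq, hA]
    simp only [inner_add_left, inner_add_right, inner_smul_left, inner_smul_right, huu, hvv, huv,
      hvu, real_inner_comm x u, real_inner_comm x v, RCLike.conj_to_real]
    linear_combination (inner ℝ x u ^ 2 + inner ℝ x v ^ 2) * Real.sin_sq_add_cos_sq t
  refine ⟨LinearIsometry.toLinearIsometryEquiv ⟨A, hn⟩ rfl, fun x => ?_⟩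
  have hL : (LinearIsometry.toLinearIsometryEquiv (⟨A, hn⟩ : E →ₗᵢ[ℝ] E) rfl) x = A x := rfl
  rw [hL, hA]
  simp only [inner_add_left, inner_smul_left, huu, hvv, huv, hvu, RCLike.conj_to_real]
  constructor <;> ring

variable [MeasurableSpace E] [BorelSpace E] {μ : Measure E}

lemma Continuous.integrable_of_ae_norm_le [IsFiniteMeasure μ] {R : ℝ} (hR : ∀ᵐ x ∂μ, ‖x‖ ≤ R)
    {φ : E → ℝ} (hφ : Continuous φ) : Integrable φ μ := by
  have h : μ.restrict (Metric.closedBall 0 R) = μ :=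
    Measure.restrict_eq_self_of_ae_mem (by simpa using hR)
  rw [← h]
  exact hφ.continuousOn.integrableOn_compact (isCompact_closedBall 0 R)

/-- The integral of `⟪x, v⟫ * f ⟪x, u⟫` does not change when `x` is rotated in the plane of `u`
and `v`; this is the vanishing of its derivative with respect to the angle. -/
lemma integral_rotation_eq_zero [IsFiniteMeasure μ] {R : ℝ} (hR : ∀ᵐ x ∂μ, ‖x‖ ≤ R)
    (hμ : ∀ L : E ≃ₗᵢ[ℝ] E, μ.map L = μ) {u v : E} (hu : ‖u‖ = 1) (hv : ‖v‖ = 1)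
    (huv : inner ℝ u v = 0) {f f' : ℝ → ℝ} (hf : ∀ x, HasDerivAt f (f' x) x)
    (hf' : Continuous f') :
    ∫ x, (inner ℝ x v ^ 2 * f' (inner ℝ x u) - inner ℝ x u * f (inner ℝ x u)) ∂μ = 0 := by
  have hfc : Continuous f := continuous_iff_continuousAt.2 fun x => (hf x).continuousAt
  obtain ⟨M, hM⟩ := (isCompact_Icc (a := -(2 * R)) (b := 2 * R)).exists_bound_of_continuousOn
    hfc.continuousOn
  obtain ⟨M', hM'⟩ := (isCompact_Icc (a := -(2 * R)) (b := 2 * R)).exists_bound_of_continuousOn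
    hf'.continuousOn
  -- `F t x` is `⟪L x, v⟫ * f ⟪L x, u⟫` for the rotation `L` by `t`, and `F'` is its `t`-derivative.
  set F : ℝ → E → ℝ := fun t x =>
    (Real.cos t * inner ℝ x v - Real.sin t * inner ℝ x u) *
      f (Real.cos t * inner ℝ x u + Real.sin t * inner ℝ x v) with hF
  set F' : ℝ → E → ℝ := fun t x =>
    (-Real.sin t * inner ℝ x v - Real.cos t * inner ℝ x u) *
      f (Real.cos t * inner ℝ x u + Real.sin t * inner ℝ x v) +
    (Real.cos t * inner ℝ x v - Real.sin t * inner ℝ x u) *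
      (f' (Real.cos t * inner ℝ x u + Real.sin t * inner ℝ x v) *
        (-Real.sin t * inner ℝ x u + Real.cos t * inner ℝ x v)) with hF'
  have hFc : ∀ t, Continuous (F t) := fun t => by fun_prop
  have hF'c : ∀ t, Continuous (F' t) := fun t => by fun_prop
  have hconst : ∀ t, ∫ x, F t x ∂μ = ∫ x, F 0 x ∂μ := by
    intro t
    obtain ⟨L, hL⟩ := exists_plane_rotation hu hv huv t
    conv_rhs => rw [← hμ L]
    rw [integral_map L.continuous.aemeasurable (hFc 0).aestronglyMeasurable]
    simp [hF, (hL _).1, (hL _).2]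
  have hcomb : ∀ {a b p q : ℝ}, |a| ≤ 1 → |b| ≤ 1 → |p| ≤ R → |q| ≤ R →
      |a * p + b * q| ≤ 2 * R := by
    intro a b p q ha hb hp hq
    calc |a * p + b * q| ≤ |a| * |p| + |b| * |q| := by
          rw [← abs_mul, ← abs_mul]; exact abs_add_le _ _
      _ ≤ 1 * R + 1 * R := by gcongr
      _ = 2 * R := by ring
  have hderiv := (hasDerivAt_integral_of_dominated_loc_of_deriv_le (μ := μ) (F := F) (F' := F')
    (x₀ := 0) (s := Set.univ) (bound := fun _ => 2 * R * M + 2 * R * (M' * (2 * R)))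
    Filter.univ_mem (.of_forall fun t => (hFc t).aestronglyMeasurable)
    ((hFc 0).integrable_of_ae_norm_le hR) (hF'c 0).aestronglyMeasurable ?_
    (integrable_const _) ?_).2
  · have h0 : ∫ x, F' 0 x ∂μ = 0 := by
      have : (fun t => ∫ x, F t x ∂μ) = fun _ => ∫ x, F 0 x ∂μ := funext hconst
      rw [this] at hderiv
      exact hderiv.unique (hasDerivAt_const _ _)
    rw [← h0]
    refine integral_congr_ae (ae_of_all _ fun x => ?_)
    simp only [hF', Real.cos_zero, Real.sin_zero]
    ring_nf
  · filter_upwards [hR] with x hx t _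
    have hxu : |inner ℝ x u| ≤ R := (abs_real_inner_le_norm x u).trans (by rwa [hu, mul_one])
    have hxv : |inner ℝ x v| ≤ R := (abs_real_inner_le_norm x v).trans (by rwa [hv, mul_one])
    have hs := Real.abs_sin_le_one t
    have hs' : |-Real.sin t| ≤ 1 := by rwa [abs_neg]
    have hc := Real.abs_cos_le_one t
    have hc' : |-Real.cos t| ≤ 1 := by rwa [abs_neg]
    have hR0 : 0 ≤ R := (abs_nonneg _).trans hxu
    have hz := hcomb hc hs hxu hxv
    have hy : |Real.cos t * inner ℝ x v - Real.sin t * inner ℝ x u| ≤ 2 * R := by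
      have := hcomb hc hs' hxv hxu
      rwa [neg_mul, ← sub_eq_add_neg] at this
    have hy' : |-Real.sin t * inner ℝ x v - Real.cos t * inner ℝ x u| ≤ 2 * R := by
      have := hcomb hs' hc' hxv hxu
      rwa [neg_mul (Real.cos t), ← sub_eq_add_neg] at this
    have hw' := hcomb hs' hc hxu hxv
    have h1 := hM _ (abs_le.1 hz)
    have h2 := hM' _ (abs_le.1 hz)
    rw [Real.norm_eq_abs] at h1 h2
    refine (abs_add_le _ _).trans ?_
    rw [abs_mul, abs_mul, abs_mul]
    have hM0 : 0 ≤ M' := (abs_nonneg _).trans h2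
    gcongr
  · refine ae_of_all _ fun x t _ => ?_
    have hz : HasDerivAt (fun t => Real.cos t * inner ℝ x u + Real.sin t * inner ℝ x v)
        (-Real.sin t * inner ℝ x u + Real.cos t * inner ℝ x v) t :=
      ((Real.hasDerivAt_cos t).mul_const _).add ((Real.hasDerivAt_sin t).mul_const _)
    have hy : HasDerivAt (fun t => Real.cos t * inner ℝ x v - Real.sin t * inner ℝ x u)
        (-Real.sin t * inner ℝ x v - Real.cos t * inner ℝ x u) t :=
      ((Real.hasDerivAt_cos t).mul_const _).sub ((Real.hasDerivAt_sin t).mul_const _)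
    exact hy.mul ((hf _).comp t hz)

/-- The Stein identity for a coordinate of a rotation-invariant random vector, obtained by summing
`integral_rotation_eq_zero` over the directions orthogonal to the coordinate. -/
lemma integral_norm_sq_sub_sq_mul_deriv [IsFiniteMeasure μ] {R : ℝ} (hR : ∀ᵐ x ∂μ, ‖x‖ ≤ R)
    (hμ : ∀ L : E ≃ₗᵢ[ℝ] E, μ.map L = μ) {u : E} (hu : ‖u‖ = 1)
    {f f' : ℝ → ℝ} (hf : ∀ x, HasDerivAt f (f' x) x) (hf' : Continuous f') :
    ∫ x, (‖x‖ ^ 2 - inner ℝ x u ^ 2) * f' (inner ℝ x u) ∂μ =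
      (Module.finrank ℝ E - 1) * ∫ x, inner ℝ x u * f (inner ℝ x u) ∂μ := by
  classical
  have hfc : Continuous f := continuous_iff_continuousAt.2 fun x => (hf x).continuousAt
  have horth : Orthonormal ℝ ((↑) : ({u} : Set E) → E) := by
    refine ⟨fun x => ?_, fun x y hxy => (hxy (Subsingleton.elim x y)).elim⟩
    rw [show (x : E) = u from x.2, hu]
  obtain ⟨s, b, hs, hb⟩ := horth.exists_orthonormalBasis_extension
  have hus : u ∈ s := hs rfl
  set i₀ : s := ⟨u, hus⟩
  have hbi : b i₀ = u := by rw [hb]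
  have hcard : ((Finset.univ.erase i₀).card : ℝ) = Module.finrank ℝ E - 1 := by
    rw [Finset.card_erase_of_mem (Finset.mem_univ _), Finset.card_univ,
      ← Module.finrank_eq_card_basis b.toBasis, Nat.cast_sub, Nat.cast_one]
    rw [Module.finrank_eq_card_basis b.toBasis]
    exact Fintype.card_pos_iff.2 ⟨i₀⟩
  have hsum : ∑ i ∈ Finset.univ.erase i₀, ∫ x, (inner ℝ x (b i) ^ 2 * f' (inner ℝ x u) -
      inner ℝ x u * f (inner ℝ x u)) ∂μ = 0 := by
    refine Finset.sum_eq_zero fun i hi => ?_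
    refine integral_rotation_eq_zero hR hμ hu (b.norm_eq_one i) ?_ hf hf'
    rw [← hbi]
    exact b.orthonormal.2 (Finset.ne_of_mem_erase hi).symm
  have hint : ∀ φ : E → ℝ, Continuous φ → Integrable φ μ := fun φ hφ =>
    hφ.integrable_of_ae_norm_le hR
  rw [← integral_finsetSum _ fun i _ => hint _ (by fun_prop)] at hsum
  have hpt : ∀ x, ∑ i ∈ Finset.univ.erase i₀, (inner ℝ x (b i) ^ 2 * f' (inner ℝ x u) -
      inner ℝ x u * f (inner ℝ x u)) = (‖x‖ ^ 2 - inner ℝ x u ^ 2) * f' (inner ℝ x u) -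
        (Module.finrank ℝ E - 1) * (inner ℝ x u * f (inner ℝ x u)) := by
    intro x
    rw [Finset.sum_sub_distrib, Finset.sum_const, nsmul_eq_mul, hcard, ← Finset.sum_mul,
      ← b.sum_sq_inner_left x, ← Finset.add_sum_erase _ _ (Finset.mem_univ i₀), hbi]
    ring
  simp only [hpt] at hsum
  rw [integral_sub (hint _ (by fun_prop)) (hint _ (by fun_prop)), integral_const_mul] at hsum
  linarith

end Rotation

/-! ### The uniform measure on the sphere -/

section Sphere

open scoped Pointwise

variable {E : Type*} [NormedAddCommGroup E] [InnerProductSpace ℝ E] [FiniteDimensional ℝ E]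
  [MeasurableSpace E] [BorelSpace E]

lemma toSphere_map_linearIsometryEquiv (L : E ≃ₗᵢ[ℝ] E) (hL : Set.MapsTo L
    (Metric.sphere (0 : E) 1) (Metric.sphere (0 : E) 1)) :
    (volume : Measure E).toSphere.map (hL.restrict L _ _) = (volume : Measure E).toSphere := by
  have hLc : Continuous (hL.restrict L _ _) := L.continuous.restrict hL
  ext s hs
  rw [Measure.map_apply hLc.measurable hs, Measure.toSphere_apply' _ (hLc.measurable hs),
    Measure.toSphere_apply' _ hs, ← MeasurePreserving.measure_preimage_equiv
      (f := L.toHomeomorph.toMeasurableEquiv) L.measurePreserving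
      (Set.Ioo (0 : ℝ) 1 • (Subtype.val '' s))]
  congr 2
  ext x
  change _ ↔ L x ∈ Set.Ioo (0 : ℝ) 1 • (Subtype.val '' s)
  simp only [Set.mem_preimage, Set.mem_smul, Set.mem_image, Subtype.exists]
  constructor
  · rintro ⟨r, hr, _, ⟨y, hy, hys, rfl⟩, rfl⟩
    exact ⟨r, hr, L y, ⟨L y, hL hy, hys, rfl⟩, (L.map_smul r y).symm⟩
  · rintro ⟨r, hr, _, ⟨y, hy, hys, rfl⟩, hx⟩
    have hy' : L.symm y ∈ Metric.sphere (0 : E) 1 := by simpa using hy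
    refine ⟨r, hr, L.symm y, ⟨L.symm y, hy', ?_, rfl⟩, ?_⟩
    · have : hL.restrict L _ _ ⟨L.symm y, hy'⟩ = ⟨y, hy⟩ := Subtype.ext (by simp)
      rwa [this]
    · apply L.injective
      rw [L.map_smul, L.apply_symm_apply]
      exact hx

end Sphere

lemma continuous_smul_sphere (n : ℕ) (r : ℝ) : Continuous
    fun x : Metric.sphere (0 : EuclideanSpace ℝ (Fin n)) 1 => r • (x : EuclideanSpace ℝ (Fin n)) := by
  fun_prop

lemma isProbabilityMeasure_sphereUniform {n : ℕ} (hn : n ≠ 0) (r : ℝ) :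
    IsProbabilityMeasure (sphereUniform n r) := by
  have : Nonempty (Fin n) := ⟨⟨0, Nat.pos_of_ne_zero hn⟩⟩
  refine ⟨?_⟩
  rw [sphereUniform, Measure.map_apply (continuous_smul_sphere n r).measurable .univ,
    Set.preimage_univ, Measure.smul_apply, smul_eq_mul]
  refine ENNReal.inv_mul_cancel ?_ (measure_ne_top _ _)
  rw [Ne, Measure.measure_univ_eq_zero]
  exact Measure.toSphere_ne_zero _

lemma sphereUniform_map_linearIsometryEquiv (n : ℕ) (r : ℝ)
    (L : EuclideanSpace ℝ (Fin n) ≃ₗᵢ[ℝ] EuclideanSpace ℝ (Fin n)) :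
    (sphereUniform n r).map L = sphereUniform n r := by
  have hL : Set.MapsTo L (Metric.sphere (0 : EuclideanSpace ℝ (Fin n)) 1)
      (Metric.sphere (0 : EuclideanSpace ℝ (Fin n)) 1) := fun x hx => by simpa using hx
  have hLc : Continuous (hL.restrict L _ _) := L.continuous.restrict hL
  have hr := (continuous_smul_sphere n r).measurable
  rw [sphereUniform, Measure.map_map L.continuous.measurable hr]
  conv_rhs => rw [← toSphere_map_linearIsometryEquiv L hL, ← Measure.map_smul,
    Measure.map_map hr hLc.measurable]
  rw [toSphere_map_linearIsometryEquiv L hL]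
  congr 1
  funext x
  simp

lemma ae_norm_eq_sphereUniform (n : ℕ) {r : ℝ} (hr : 0 ≤ r) :
    ∀ᵐ x ∂sphereUniform n r, ‖x‖ = r := by
  rw [sphereUniform, ae_map_iff (continuous_smul_sphere n r).aemeasurable
    (measurableSet_eq_fun (by fun_prop) (by fun_prop))]
  refine ae_of_all _ fun x => ?_
  rw [norm_smul, Real.norm_of_nonneg hr, norm_eq_of_mem_sphere, mul_one]

/-! ### A coordinate of a uniform point on the sphere -/

section Coordinate

variable {n : ℕ} {θ : EuclideanSpace ℝ (Fin n)}

lemma Continuous.integrable_sphereUniform (hn : n ≠ 0) {r : ℝ} (hr : 0 ≤ r)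
    {φ : EuclideanSpace ℝ (Fin n) → ℝ} (hφ : Continuous φ) : Integrable φ (sphereUniform n r) :=
  have := isProbabilityMeasure_sphereUniform hn r
  hφ.integrable_of_ae_norm_le ((ae_norm_eq_sphereUniform n hr).mono fun _ h => h.le)

/-- The Stein identity for a coordinate of a uniform point on the sphere of radius `√n`. -/
lemma sphereUniform_stein_identity (hn : n ≠ 0) (hθ : ‖θ‖ = 1) {f f' : ℝ → ℝ}
    (hf : ∀ x, HasDerivAt f (f' x) x) (hf' : Continuous f') :
    ∫ x, (n - inner ℝ x θ ^ 2) * f' (inner ℝ x θ) ∂sphereUniform n √n =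
      (n - 1) * ∫ x, inner ℝ x θ * f (inner ℝ x θ) ∂sphereUniform n √n := by
  have := isProbabilityMeasure_sphereUniform hn √n
  have hae := ae_norm_eq_sphereUniform n (Real.sqrt_nonneg n)
  have h := integral_norm_sq_sub_sq_mul_deriv (hae.mono fun _ h => h.le)
    (sphereUniform_map_linearIsometryEquiv n √n) hθ hf hf'
  rw [finrank_euclideanSpace_fin] at h
  rw [← h]
  refine integral_congr_ae (hae.mono fun x hx => ?_)
  simp only [hx, Real.sq_sqrt (Nat.cast_nonneg n)]

lemma integral_inner_sq_sphereUniform (hn : n ≠ 0) (hθ : ‖θ‖ = 1) :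
    ∫ x, inner ℝ x θ ^ 2 ∂sphereUniform n √n = 1 := by
  have := isProbabilityMeasure_sphereUniform hn √n
  have h := sphereUniform_stein_identity hn hθ (f := id) (f' := fun _ => 1) hasDerivAt_id
    continuous_const
  have hint : Integrable (fun x => inner ℝ x θ ^ 2) (sphereUniform n √n) :=
    Continuous.integrable_sphereUniform hn (Real.sqrt_nonneg _) (by fun_prop)
  simp only [mul_one, id, ← pow_two] at h
  rw [integral_sub (integrable_const _) hint] at h
  simp only [integral_const, probReal_univ, one_smul] at h
  have hn' : (n : ℝ) ≠ 0 := Nat.cast_ne_zero.2 hn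
  apply mul_left_cancel₀ hn'
  linarith

lemma integral_inner_pow_four_sphereUniform (hn : n ≠ 0) (hθ : ‖θ‖ = 1) :
    (n + 2) * ∫ x, inner ℝ x θ ^ 4 ∂sphereUniform n √n = 3 * n := by
  have h := sphereUniform_stein_identity hn hθ (f := fun x => x ^ 3) (f' := fun x => 3 * x ^ 2)
    (fun x => by simpa using hasDerivAt_pow 3 x) (by fun_prop)
  have hint : ∀ φ : EuclideanSpace ℝ (Fin n) → ℝ, Continuous φ →
      Integrable φ (sphereUniform n √n) :=
    fun φ hφ => hφ.integrable_sphereUniform hn (Real.sqrt_nonneg _)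
  have h1 : ∀ x : EuclideanSpace ℝ (Fin n), (n - inner ℝ x θ ^ 2) * (3 * inner ℝ x θ ^ 2) =
      3 * n * inner ℝ x θ ^ 2 - 3 * inner ℝ x θ ^ 4 := fun x => by ring
  have h2 : ∀ x : EuclideanSpace ℝ (Fin n), inner ℝ x θ * inner ℝ x θ ^ 3 = inner ℝ x θ ^ 4 :=
    fun x => by ring
  simp only [h1, h2] at h
  rw [integral_sub (hint _ (by fun_prop)) (hint _ (by fun_prop)), integral_const_mul,
    integral_const_mul, integral_inner_sq_sphereUniform hn hθ] at h
  linarith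

lemma integral_abs_inner_sq_sub_one_le (hn : n ≠ 0) (hθ : ‖θ‖ = 1) :
    ∫ x, |inner ℝ x θ ^ 2 - 1| ∂sphereUniform n √n ≤ √(2 * (n - 1) / (n + 2)) := by
  have := isProbabilityMeasure_sphereUniform hn √n
  have hint : ∀ φ : EuclideanSpace ℝ (Fin n) → ℝ, Continuous φ →
      Integrable φ (sphereUniform n √n) :=
    fun φ hφ => hφ.integrable_sphereUniform hn (Real.sqrt_nonneg _)
  -- The Cauchy-Schwarz inequality, in the form that `|W ^ 2 - 1|` has nonnegative variance.
  set Y : EuclideanSpace ℝ (Fin n) → ℝ := fun x => |inner ℝ x θ ^ 2 - 1| with hY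
  have hYc : Continuous Y := by fun_prop
  have hY2 : MemLp Y 2 (sphereUniform n √n) :=
    (memLp_two_iff_integrable_sq hYc.aestronglyMeasurable).2 (hint _ (by fun_prop))
  have hv := variance_nonneg Y (sphereUniform n √n)
  rw [variance_eq_sub hY2] at hv
  have h4 := integral_inner_pow_four_sphereUniform hn hθ
  have h2 := integral_inner_sq_sphereUniform hn hθ
  have hn2 : (0 : ℝ) < n + 2 := by positivity
  have hsq : ∫ x, (Y ^ 2) x ∂sphereUniform n √n = 2 * (n - 1) / (n + 2) := by
    have : ∀ x, (Y ^ 2) x = inner ℝ x θ ^ 4 - 2 * inner ℝ x θ ^ 2 + 1 := fun x => by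
      simp only [Pi.pow_apply, hY, sq_abs]; ring
    simp only [this]
    rw [integral_add (hint _ (by fun_prop)) (integrable_const _),
      integral_sub (hint _ (by fun_prop)) (hint _ (by fun_prop)), integral_const_mul, h2]
    simp only [integral_const, probReal_univ, one_smul]
    rw [eq_div_iff hn2.ne']
    linarith
  rw [hsq] at hv
  exact Real.le_sqrt_of_sq_le (by linarith)

/-- Testing the law of a coordinate against a bounded continuous `g`: the Gaussian Stein equation
turns the difference of expectations into `𝔼 [f' W - W f W]`, which by the Stein identity on the
sphere equals `𝔼 [f' W (W ^ 2 - 1)] / (n - 1)`. -/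
lemma abs_integral_inner_sub_integral_gaussian_le (hn : 2 ≤ n) (hθ : ‖θ‖ = 1) {g : ℝ → ℝ}
    (hg : Continuous g) (hg1 : ∀ x, |g x| ≤ 1) :
    |∫ x, g (inner ℝ x θ) ∂sphereUniform n √n - ∫ z, g z ∂gaussianReal 0 1| ≤
      4 * √(2 * (n - 1) / (n + 2)) / (n - 1) := by
  have hn0 : n ≠ 0 := by omega
  have hn1 : (0 : ℝ) < n - 1 := by
    have : (2 : ℝ) ≤ n := by exact_mod_cast hn
    linarith
  have := isProbabilityMeasure_sphereUniform hn0 √n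
  have hint : ∀ φ : EuclideanSpace ℝ (Fin n) → ℝ, Continuous φ →
      Integrable φ (sphereUniform n √n) :=
    fun φ hφ => hφ.integrable_sphereUniform hn0 (Real.sqrt_nonneg _)
  have hgi : Integrable g (gaussianReal 0 1) :=
    .of_bound hg.aestronglyMeasurable 1 (ae_of_all _ hg1)
  have hm : |∫ z, g z ∂gaussianReal 0 1| ≤ 1 := by
    simpa using norm_integral_le_of_norm_le_const (μ := gaussianReal 0 1) (f := g) (C := 1)
      (ae_of_all _ hg1)
  obtain ⟨f, f', hf'c, hf, hstein, hbound⟩ := exists_stein_solution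
    (h := fun t => g t - ∫ z, g z ∂gaussianReal 0 1) (c := 2) (by fun_prop)
    (fun x => (abs_sub _ _).trans (by linarith [hg1 x])) (integral_mul_exp_neg_half_mul_sq_eq_zero hgi)
  have hfc : Continuous f := continuous_iff_continuousAt.2 fun x => (hf x).continuousAt
  have hid := sphereUniform_stein_identity hn0 hθ hf hf'c
  have hdiff : (n - 1) * (∫ x, g (inner ℝ x θ) ∂sphereUniform n √n - ∫ z, g z ∂gaussianReal 0 1) =
      ∫ x, f' (inner ℝ x θ) * (inner ℝ x θ ^ 2 - 1) ∂sphereUniform n √n := by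
    have h1 : ∫ x, g (inner ℝ x θ) ∂sphereUniform n √n - ∫ z, g z ∂gaussianReal 0 1 =
        ∫ x, f' (inner ℝ x θ) ∂sphereUniform n √n -
          ∫ x, inner ℝ x θ * f (inner ℝ x θ) ∂sphereUniform n √n := by
      rw [← integral_sub (hint _ (by fun_prop)) (hint _ (by fun_prop))]
      simp only [hstein]
      rw [integral_sub (hint _ (by fun_prop)) (integrable_const _)]
      simp
    rw [h1, mul_sub, ← hid, ← integral_const_mul,
      ← integral_sub (hint _ (by fun_prop)) (hint _ (by fun_prop))]
    exact integral_congr_ae (ae_of_all _ fun x => by ring)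
  have habs : |∫ x, f' (inner ℝ x θ) * (inner ℝ x θ ^ 2 - 1) ∂sphereUniform n √n| ≤
      4 * ∫ x, |inner ℝ x θ ^ 2 - 1| ∂sphereUniform n √n := by
    rw [← integral_const_mul, ← Real.norm_eq_abs]
    refine norm_integral_le_of_norm_le (hint _ (by fun_prop)) (ae_of_all _ fun x => ?_)
    rw [Real.norm_eq_abs, abs_mul]
    gcongr
    linarith [hbound (inner ℝ x θ)]
  rw [← hdiff, abs_mul, abs_of_pos hn1] at habs
  rw [le_div_iff₀ hn1, mul_comm]
  linarith [integral_abs_inner_sq_sub_one_le hn0 hθ]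

end Coordinate

theorem corollary4p2 {Ω Ω' : Type*} [MeasurableSpace Ω] [MeasurableSpace Ω']
    (P : Measure Ω) [IsProbabilityMeasure P] (Q : Measure Ω') [IsProbabilityMeasure Q]
    (n : ℕ) (hn : 2 ≤ n)
    (X : Ω → EuclideanSpace ℝ (Fin n)) (hX : HasLaw X (sphereUniform n (Real.sqrt n)) P)
    (θ : EuclideanSpace ℝ (Fin n)) (hθ : ‖θ‖ = 1)
    (Z : Ω' → ℝ) (hZ : HasLaw Z (gaussianReal 0 1) Q) :
    tvDist (fun ω => inner ℝ (X ω) θ) P Z Q ≤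
      2 * Real.sqrt 2 / Real.sqrt (((n : ℝ) - 1) * ((n : ℝ) + 2)) := by
  have hn1 : (0 : ℝ) < n - 1 := by
    have : (2 : ℝ) ≤ n := by exact_mod_cast hn
    linarith
  have hn2 : (0 : ℝ) < n + 2 := by positivity
  have hconst : (1 / 2) * (4 * √(2 * ((n : ℝ) - 1) / (n + 2)) / (n - 1)) =
      2 * √2 / √(((n : ℝ) - 1) * (n + 2)) := by
    rw [Real.sqrt_div (by positivity), Real.sqrt_mul (by norm_num), Real.sqrt_mul hn1.le]
    have h1 : √((n : ℝ) - 1) ≠ 0 := (Real.sqrt_pos.2 hn1).ne'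
    have h2 : √((n : ℝ) + 2) ≠ 0 := (Real.sqrt_pos.2 hn2).ne'
    field_simp
    rw [Real.sq_sqrt hn1.le]
    ring
  rw [tvDist, ← hconst]
  refine mul_le_mul_of_nonneg_left (Real.sSup_le ?_ (by positivity)) (by norm_num)
  rintro d ⟨g, hg, hg1, rfl⟩
  have hgX : ∫ ω, g (inner ℝ (X ω) θ) ∂P = ∫ x, g (inner ℝ x θ) ∂sphereUniform n √n :=
    hX.integral_comp (f := fun x => g (inner ℝ x θ))
      (Continuous.aestronglyMeasurable (by fun_prop))
  have hgZ : ∫ ω, g (Z ω) ∂Q = ∫ z, g z ∂gaussianReal 0 1 :=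
    hZ.integral_comp hg.aestronglyMeasurable
  rw [hgX, hgZ]
  exact abs_integral_inner_sub_integral_gaussian_le hn hθ hg hg1
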